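/- Let $d\ge 1$, and let $F_n$ ($n\in\mathbb{N}$) and $F$ be distribution functions of random vectors $X^{(n)}$ and $X$ in $\mathbb{R}^d$ satisfying the condition $(\mathcal H)$: each component is almost surely nonnegative and has finite, strictly positive expectation. For such a distribution function $F$ of $X=(X_1,\dots,X_d)$, let the $F$-norm on $\mathbb{R}^{d+1}$ be $$\|x\|_F = E\bigl(\max(|x_0|,|x_1|X_1,\dots,|x_d|X_d)\bigr),\qquad x=(x_0,x_1,\dots,x_d)\in\mathbb{R}^{d+1},$$ with unit sphere $S_F=\{x\in\mathbb{R}^{d+1}:\|x\|_F=1\}$. Let the Wasserstein distance be $$d_W(F,G)=\inf\Bigl\{E\Bigl(\sum_{i=1}^d|X_i-Y_i|\Bigr) : X \text{ has distribution function } F,\ Y \text{ has distribution function } G\Bigr\},$$ and for a norm $\|\cdot\|$ on $\mathbb{R}^{d+1}$ and $A,B\subset\mathbb{R}^{d+1}$ let $$d_{H,\|\cdot\|}(A,B)=\max\Bigl\{\sup_{y\in B}\inf_{x\in A}\|x-y\|,\ \sup_{x\in A}\inf_{y\in B}\|x-y\|\Bigr\}.$$ Then, for every norm $\|\cdot\|$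 on $\mathbb{R}^{d+1}$, $$d_W(F_n,F)\to 0 \quad\Longleftrightarrow\quad d_{H,\|\cdot\|}(S_{F_n},S_F)\to 0 \qquad (n\to\infty).$$ -/

import Mathlib

open MeasureTheory Filter Topology
open scoped ENNReal

namespace FNorm

/-- `μ` is a probability distribution on `ℝ^d` with distribution function `F`. -/
def HasDF {d : ℕ} (μ : Measure (Fin d → ℝ)) (F : (Fin d → ℝ) → ℝ) : Prop :=
  IsProbabilityMeasure μ ∧ ∀ x, F x = μ.real (Set.Iic x)

/-- A distribution function on `ℝ^d`: `F x = P (X₁ ≤ x₁, …, X_d ≤ x_d)` for some random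
vector `X`. -/
def IsDF {d : ℕ} (F : (Fin d → ℝ) → ℝ) : Prop :=
  ∃ μ : Measure (Fin d → ℝ), HasDF μ F

open Classical in
/-- The distribution with distribution function `F`; it is unique, see `law_eq` (and the value is
`0` if `F` is not a distribution function). -/
noncomputable def law {d : ℕ} (F : (Fin d → ℝ) → ℝ) : Measure (Fin d → ℝ) :=
  if h : IsDF F then h.choose else 0

theorem hasDF_law {d : ℕ} {F : (Fin d → ℝ) → ℝ} (h : IsDF F) : HasDF (law F) F := by
  rw [law, dif_pos h]
  exact h.choose_spec

/-- A distribution on `ℝ^d` is determined by its distribution function. -/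
theorem HasDF.unique {d : ℕ} {F : (Fin d → ℝ) → ℝ} {μ ν : Measure (Fin d → ℝ)}
    (hμ : HasDF μ F) (hν : HasDF ν F) : μ = ν := by
  have := hμ.1
  have := hν.1
  have hgen : (MeasurableSpace.pi : MeasurableSpace (Fin d → ℝ)) =
      MeasurableSpace.generateFrom
        (Set.pi Set.univ '' Set.pi Set.univ fun _ : Fin d => Set.range (Set.Iic : ℝ → Set ℝ)) := by
    refine (generateFrom_eq_pi (C := fun _ : Fin d => Set.range (Set.Iic : ℝ → Set ℝ))
      (fun _ => ?_) (fun _ => ?_)).symm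
    · rw [BorelSpace.measurable_eq (α := ℝ), borel_eq_generateFrom_Iic]
    · refine ⟨fun n : ℕ => Set.Iic (n : ℝ), fun n => ⟨_, rfl⟩, ?_⟩
      ext x
      simpa using exists_nat_ge x
  refine ext_of_generate_finite _ hgen (IsPiSystem.pi fun _ => ?_) ?_ (by simp)
  · simpa using isPiSystem_image_Iic (Set.univ : Set ℝ)
  · rintro _ ⟨s, hs, rfl⟩
    choose a ha using fun i => hs i (Set.mem_univ i)
    have hs' : s = fun i => Set.Iic (a i) := funext fun i => (ha i).symm
    have h : Set.pi Set.univ s = Set.Iic a := by rw [hs', Set.pi_univ_Iic]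
    rw [h]
    have h2 := (hμ.2 a).symm.trans (hν.2 a)
    exact (measureReal_eq_measureReal_iff).1 h2

theorem law_eq {d : ℕ} {F : (Fin d → ℝ) → ℝ} {μ : Measure (Fin d → ℝ)} (h : HasDF μ F) :
    law F = μ :=
  (hasDF_law ⟨μ, h⟩).unique h

/-- Condition `(H)`: `F` is the distribution function of a random vector `X = (X₁, …, X_d)` each
component of which is almost surely nonnegative with `0 < E(X_i) < ∞`. -/
def ConditionH {d : ℕ} (F : (Fin d → ℝ) → ℝ) : Prop :=
  IsDF F ∧ ∀ i : Fin d, (∀ᵐ X ∂(law F), 0 ≤ X i) ∧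
    Integrable (fun X : Fin d → ℝ => X i) (law F) ∧ 0 < ∫ X, X i ∂(law F)

/-- The `F`-norm on `ℝ^{d+1}`: `‖x‖_F = E (max (|x₀|, |x₁| X₁, …, |x_d| X_d))` where `X` has
distribution function `F`. -/
noncomputable def fNorm {d : ℕ} (F : (Fin d → ℝ) → ℝ) (x : Fin (d + 1) → ℝ) : ℝ :=
  ∫ X, max |x 0| (⨆ i : Fin d, |x i.succ| * X i) ∂(law F)

/-- The unit sphere of the `F`-norm. -/
def unitSphere {d : ℕ} (F : (Fin d → ℝ) → ℝ) : Set (Fin (d + 1) → ℝ) :=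
  {x | fNorm F x = 1}

/-- The Wasserstein distance
`inf {E ‖X - Y‖₁ : X has distribution function F, Y has distribution function G}`; the measure `π`
is the joint distribution of `(X, Y)`. -/
noncomputable def wassersteinDist {d : ℕ} (F G : (Fin d → ℝ) → ℝ) : ℝ≥0∞ :=
  ⨅ (π : Measure ((Fin d → ℝ) × (Fin d → ℝ)))
    (_ : π.map Prod.fst = law F ∧ π.map Prod.snd = law G),
    ∫⁻ z, ENNReal.ofReal (∑ i, |z.1 i - z.2 i|) ∂π

/-- The Hausdorff distance of two subsets of a real vector space with respect to a norm `p`. -/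
noncomputable def hausdorffDistOf {E : Type*} [AddCommGroup E] [Module ℝ E] (p : Seminorm ℝ E)
    (A B : Set E) : ℝ≥0∞ :=
  max (⨆ y ∈ B, ⨅ x ∈ A, ENNReal.ofReal (p (x - y)))
    (⨆ x ∈ A, ⨅ y ∈ B, ENNReal.ofReal (p (x - y)))

end FNorm

/-!
The `F`-norm at `x` is the expectation of the maximum of `|x₀|` and the `|x_i| X_i`. Both sides of
the equivalence amount to the pointwise convergence of the `F`-norms.

The integrand is Lipschitz in `X` for the `ℓ¹` distance with constant `‖x‖`, so that
`|‖x‖_F - ‖x‖_G| ≤ ‖x‖ d_W(F, G)` (`abs_fNorm_sub_le`). Wasserstein convergence therefore makes the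
norms converge uniformly on bounded sets, and rescaling the points of one unit sphere onto the other
shows that the spheres converge (`tendsto_hausdorffDistOf_sphere`). Conversely, if the spheres
converge, they stay away from the origin, so the norms are uniformly bounded by a multiple of `p`,
and this gives pointwise convergence of the norms (`tendsto_of_tendsto_hausdorffDistOf_sphere`).

It remains to deduce Wasserstein convergence from pointwise convergence of the norms. The norms of
the coordinate vectors are the means of the components. For fixed `y` the function
`s ↦ ‖(s, y)‖_F = E (max s M)`, with `M` the maximum of the `|y_i| X_i`, is convex with derivative
the distribution function of `M`; squeezing the latter between difference quotients gives
convergence of the masses of lower orthants (`tendsto_law_Iic`), hence of the cells of a generic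
grid (`tendsto_measure_gridCell`). To conclude, couple the two laws so that each of finitely many
diagonal cells gets the smaller of the two masses of the cell (`exists_coupling_diagonal_cells`).
As `|s - t| = s + t - 2 min s t` for `s, t ≥ 0`, the transport cost is at most the sum of both means
minus twice the mean obtained by rounding down to lower corners of the cells
(`lintegral_cost_add_le`). In the limit this is twice the error of discretising the mean of the
limit law, which is as small as desired.
-/

namespace FNorm

/-! ### Couplings that charge the diagonal cells -/

/-- Finite measures of equal mass are the marginals of a measure: the normalised product. -/
theorem exists_coupling {E : Type*} [MeasurableSpace E] (α β : Measure E) [IsFiniteMeasure α]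
    [IsFiniteMeasure β] (h : α Set.univ = β Set.univ) :
    ∃ π : Measure (E × E), π.map Prod.fst = α ∧ π.map Prod.snd = β := by
  by_cases h0 : α Set.univ = 0
  · have hα : α = 0 := Measure.measure_univ_eq_zero.1 h0
    have hβ : β = 0 := Measure.measure_univ_eq_zero.1 (h ▸ h0)
    exact ⟨0, by simp [hα], by simp [hβ]⟩
  · refine ⟨(α Set.univ)⁻¹ • α.prod β, ?_, ?_⟩
    · rw [Measure.map_smul, Measure.map_fst_prod, ← h, smul_smul,
        ENNReal.inv_mul_cancel h0 (measure_ne_top _ _), one_smul]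
    · rw [Measure.map_smul, Measure.map_snd_prod, smul_smul,
        ENNReal.inv_mul_cancel h0 (measure_ne_top _ _), one_smul]

/-- The restriction of a finite measure to `B` dominates a measure of any prescribed mass up to that
of `B`: scale it down. -/
theorem exists_scaled_restrict {E : Type*} [MeasurableSpace E] (μ : Measure E) [IsFiniteMeasure μ]
    (B : Set E) {m : ℝ≥0∞} (hm : m ≤ μ B) :
    ∃ α : Measure E, α ≤ μ.restrict B ∧ α Set.univ = m := by
  refine ⟨(m / μ B) • μ.restrict B, ?_, ?_⟩
  · refine Measure.le_iff.2 fun s _ => ?_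
    rw [Measure.smul_apply, smul_eq_mul]
    exact mul_le_of_le_one_left' (ENNReal.div_le_of_le_mul (by simpa using hm))
  · rw [Measure.smul_apply, smul_eq_mul, Measure.restrict_apply_univ]
    by_cases h0 : μ B = 0
    · rw [h0, mul_zero]
      exact (nonpos_iff_eq_zero.1 (h0 ▸ hm)).symm
    · exact ENNReal.div_mul_cancel h0 (measure_ne_top _ _)

theorem sum_le_of_le_restrict {E ι : Type*} [MeasurableSpace E] (K : Finset ι) (μ : Measure E)
    (B : ι → Set E) (hB : ∀ k, MeasurableSet (B k)) (hd : Pairwise (Function.onFun Disjoint B))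
    (α : ι → Measure E) (hα : ∀ k, α k ≤ μ.restrict (B k)) : ∑ k ∈ K, α k ≤ μ := by
  refine Measure.le_iff.2 fun s hs => ?_
  rw [Measure.finsetSum_apply]
  calc ∑ k ∈ K, α k s ≤ ∑ k ∈ K, μ (s ∩ B k) :=
        Finset.sum_le_sum fun k _ => (hα k s).trans_eq (Measure.restrict_apply hs)
    _ = μ (⋃ k ∈ K, s ∩ B k) := (measure_biUnion_finset
        (fun i _ j _ hij => (hd hij).mono Set.inter_subset_right Set.inter_subset_right)
        fun k _ => hs.inter (hB k)).symm
    _ ≤ μ s := measure_mono (by simp)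

/-- Two probability measures have a coupling that gives each diagonal cell `B k ×ˢ B k` the largest
possible mass: couple common parts of the restrictions to each cell, then couple what is left. -/
theorem exists_coupling_diagonal_cells {E ι : Type*} [MeasurableSpace E] (K : Finset ι)
    (μ ν : Measure E) [IsProbabilityMeasure μ] [IsProbabilityMeasure ν]
    (B : ι → Set E) (hB : ∀ k, MeasurableSet (B k)) (hd : Pairwise (Function.onFun Disjoint B)) :
    ∃ π : Measure (E × E), (π.map Prod.fst = μ ∧ π.map Prod.snd = ν) ∧
      ∀ k ∈ K, min (μ (B k)) (ν (B k)) ≤ π (B k ×ˢ B k) := by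
  choose α hα hα' using fun k => exists_scaled_restrict μ (B k) (min_le_left _ (ν (B k)))
  choose β hβ hβ' using fun k => exists_scaled_restrict ν (B k) (min_le_right (μ (B k)) _)
  have hαμ : ∑ k ∈ K, α k ≤ μ := sum_le_of_le_restrict K μ B hB hd α hα
  have hβν : ∑ k ∈ K, β k ≤ ν := sum_le_of_le_restrict K ν B hB hd β hβ
  have : IsFiniteMeasure (∑ k ∈ K, α k) := isFiniteMeasure_of_le μ hαμ
  have : IsFiniteMeasure (∑ k ∈ K, β k) := isFiniteMeasure_of_le ν hβν
  have hfα : ∀ k, IsFiniteMeasure (α k) := fun k => isFiniteMeasure_of_le _ (hα k)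
  have hfβ : ∀ k, IsFiniteMeasure (β k) := fun k => isFiniteMeasure_of_le _ (hβ k)
  choose π hπ₁ hπ₂ using fun k => exists_coupling (α k) (β k) ((hα' k).trans (hβ' k).symm)
  obtain ⟨ρ, hρ₁, hρ₂⟩ := exists_coupling (μ - ∑ k ∈ K, α k) (ν - ∑ k ∈ K, β k) (by
    rw [Measure.sub_apply MeasurableSet.univ hαμ, Measure.sub_apply MeasurableSet.univ hβν,
      Measure.finsetSum_apply, Measure.finsetSum_apply, measure_univ, measure_univ]
    simp only [hα', hβ'])
  refine ⟨ρ + ∑ k ∈ K, π k, ⟨?_, ?_⟩, fun k hk => ?_⟩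
  · rw [Measure.map_add _ _ measurable_fst, hρ₁, ← Measure.mapₗ_apply_of_measurable measurable_fst,
      map_sum]
    simp only [Measure.mapₗ_apply_of_measurable measurable_fst, hπ₁]
    exact Measure.sub_add_cancel_of_le hαμ
  · rw [Measure.map_add _ _ measurable_snd, hρ₂, ← Measure.mapₗ_apply_of_measurable measurable_snd,
      map_sum]
    simp only [Measure.mapₗ_apply_of_measurable measurable_snd, hπ₂]
    exact Measure.sub_add_cancel_of_le hβν
  · have h1 : π k (Prod.fst ⁻¹' (B k)ᶜ) = 0 := by
      rw [← Measure.map_apply measurable_fst (hB k).compl, hπ₁]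
      exact nonpos_iff_eq_zero.1 ((hα k _).trans_eq (by simp [Measure.restrict_apply (hB k).compl]))
    have h2 : π k (Prod.snd ⁻¹' (B k)ᶜ) = 0 := by
      rw [← Measure.map_apply measurable_snd (hB k).compl, hπ₂]
      exact nonpos_iff_eq_zero.1 ((hβ k _).trans_eq (by simp [Measure.restrict_apply (hB k).compl]))
    have h3 : π k Set.univ = min (μ (B k)) (ν (B k)) := by
      rw [← hα' k, ← hπ₁ k, Measure.map_apply measurable_fst MeasurableSet.univ, Set.preimage_univ]
    calc min (μ (B k)) (ν (B k)) = π k Set.univ := h3.symm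
      _ ≤ π k (B k ×ˢ B k ∪ (Prod.fst ⁻¹' (B k)ᶜ ∪ Prod.snd ⁻¹' (B k)ᶜ)) :=
          measure_mono fun z _ => by
            by_cases h1 : z.1 ∈ B k <;> by_cases h2 : z.2 ∈ B k <;> simp [h1, h2]
      _ ≤ π k (B k ×ˢ B k) + (π k (Prod.fst ⁻¹' (B k)ᶜ) + π k (Prod.snd ⁻¹' (B k)ᶜ)) :=
          (measure_union_le _ _).trans (add_le_add_right (measure_union_le _ _) _)
      _ = π k (B k ×ˢ B k) := by rw [h1, h2, add_zero, add_zero]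
      _ ≤ ∑ j ∈ K, π j (B k ×ˢ B k) :=
          Finset.single_le_sum (f := fun j => π j (B k ×ˢ B k)) (fun _ _ => zero_le) hk
      _ ≤ (ρ + ∑ j ∈ K, π j) (B k ×ˢ B k) := by
          rw [Measure.add_apply, Measure.finsetSum_apply]
          exact le_add_self

/-! ### From masses of grid cells to the Wasserstein distance -/

/-- For nonnegative coordinates `|s - t| = s + t - 2 min s t`, so mass on a diagonal cell lowers the
transport cost by twice the coordinate sum of the lower corner of that cell. -/
theorem lintegral_cost_add_le {d : ℕ} {ι : Type*} (K : Finset ι)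
    (π : Measure ((Fin d → ℝ) × (Fin d → ℝ)))
    (hπ : ∀ᵐ z ∂π, (∀ i, 0 ≤ z.1 i) ∧ ∀ i, 0 ≤ z.2 i)
    (B : ι → Set (Fin d → ℝ)) (hB : ∀ k, MeasurableSet (B k))
    (hd : Pairwise (Function.onFun Disjoint B)) (l : ι → Fin d → ℝ)
    (hl : ∀ k, ∀ x ∈ B k, ∀ i, l k i ≤ x i) :
    ∫⁻ z, ENNReal.ofReal (∑ i, |z.1 i - z.2 i|) ∂π +
        2 * ∑ k ∈ K, ENNReal.ofReal (∑ i, max (l k i) 0) * π (B k ×ˢ B k) ≤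
      ∫⁻ z, ENNReal.ofReal (∑ i, z.1 i) ∂π + ∫⁻ z, ENNReal.ofReal (∑ i, z.2 i) ∂π := by
  have hm : ∀ k, MeasurableSet (B k ×ˢ B k) := fun k => (hB k).prod (hB k)
  have hsum : ∑ k ∈ K, ENNReal.ofReal (∑ i, max (l k i) 0) * π (B k ×ˢ B k) =
      ∫⁻ z, ∑ k ∈ K, (B k ×ˢ B k).indicator
        (fun _ => ENNReal.ofReal (∑ i, max (l k i) 0)) z ∂π := by
    rw [lintegral_finsetSum _ fun k _ => measurable_const.indicator (hm k)]
    exact Finset.sum_congr rfl fun k _ => (lintegral_indicator_const (hm k) _).symm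
  have hpt : ∀ z : (Fin d → ℝ) × (Fin d → ℝ), (∀ i, 0 ≤ z.1 i) → (∀ i, 0 ≤ z.2 i) →
      ∑ k ∈ K, (B k ×ˢ B k).indicator (fun _ => ENNReal.ofReal (∑ i, max (l k i) 0)) z ≤
        ENNReal.ofReal (∑ i, min (z.1 i) (z.2 i)) := by
    intro z h1 h2
    by_cases hz : ∃ k ∈ K, z ∈ B k ×ˢ B k
    · obtain ⟨k, hk, hzk⟩ := hz
      rw [Finset.sum_eq_single k, Set.indicator_of_mem hzk]
      · refine ENNReal.ofReal_le_ofReal (Finset.sum_le_sum fun i _ => ?_)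
        exact max_le (le_min (hl k _ hzk.1 i) (hl k _ hzk.2 i)) (le_min (h1 i) (h2 i))
      · intro j _ hj
        exact Set.indicator_of_notMem
          (fun hzj => (Set.disjoint_left.1 (hd hj) hzj.1 hzk.1).elim) _
      · exact fun h => (h hk).elim
    · rw [Finset.sum_eq_zero fun k hk => Set.indicator_of_notMem (fun h => hz ⟨k, hk, h⟩) _]
      exact zero_le
  have hmS : Measurable fun z : (Fin d → ℝ) × (Fin d → ℝ) =>
      ∑ k ∈ K, (B k ×ˢ B k).indicator (fun _ => ENNReal.ofReal (∑ i, max (l k i) 0)) z :=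
    Finset.measurable_fun_sum _ fun k _ => measurable_const.indicator (hm k)
  rw [hsum, ← lintegral_const_mul _ hmS, ← lintegral_add_right _ (hmS.const_mul 2),
    ← lintegral_add_right _ (by fun_prop)]
  refine lintegral_mono_ae ?_
  filter_upwards [hπ] with z hz
  refine (add_le_add_right (mul_le_mul_right (hpt z hz.1 hz.2) 2) _).trans_eq ?_
  rw [← ENNReal.ofReal_ofNat 2, ← ENNReal.ofReal_mul (by norm_num), ← ENNReal.ofReal_add
    (Finset.sum_nonneg fun i _ => abs_nonneg _) (mul_nonneg (by norm_num)
      (Finset.sum_nonneg fun i _ => le_min (hz.1 i) (hz.2 i))), ← ENNReal.ofReal_add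
    (Finset.sum_nonneg fun i _ => hz.1 i) (Finset.sum_nonneg fun i _ => hz.2 i)]
  rw [Finset.mul_sum, ← Finset.sum_add_distrib, ← Finset.sum_add_distrib]
  congr 1
  refine Finset.sum_congr rfl fun i _ => ?_
  rcases le_total (z.1 i) (z.2 i) with h | h
  · rw [min_eq_left h, abs_of_nonpos (by linarith)]; ring
  · rw [min_eq_right h, abs_of_nonneg (by linarith)]; ring

/-- The half-open cell with upper corner `c + k δ` of the grid of mesh `δ` through `c`. -/
def gridCell {d : ℕ} (c δ : ℝ) (k : Fin d → ℤ) : Set (Fin d → ℝ) :=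
  {x | ∀ i, ⌈(x i - c) / δ⌉ = k i}

theorem measurableSet_gridCell {d : ℕ} (c δ : ℝ) (k : Fin d → ℤ) :
    MeasurableSet (gridCell c δ k) := by
  have : gridCell c δ k = ⋂ i, (fun x : Fin d → ℝ => ⌈(x i - c) / δ⌉) ⁻¹' {k i} := by
    ext x; simp [gridCell]
  rw [this]
  refine MeasurableSet.iInter fun i => ?_
  have hm : Measurable fun x : Fin d → ℝ => ⌈(x i - c) / δ⌉ :=
    Int.measurable_ceil.comp (by fun_prop)
  exact hm (measurableSet_singleton _)

theorem pairwise_disjoint_gridCell {d : ℕ} (c δ : ℝ) :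
    Pairwise (Function.onFun Disjoint (gridCell (d := d) c δ)) := fun _ _ h =>
  Set.disjoint_left.2 fun _ hx hx' => h (funext fun i => (hx i).symm.trans (hx' i))

theorem mem_gridCell_iff {d : ℕ} {c δ : ℝ} (hδ : 0 < δ) {k : Fin d → ℤ} {x : Fin d → ℝ} :
    x ∈ gridCell c δ k ↔ ∀ i, c + (k i - 1 : ℤ) * δ < x i ∧ x i ≤ c + k i * δ := by
  refine forall_congr' fun i => ?_
  rw [Int.ceil_eq_iff, lt_div_iff₀ hδ, div_le_iff₀ hδ, lt_sub_iff_add_lt', sub_le_iff_le_add']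
  push_cast
  rfl

/-- All but countably many translates of a grid avoid `0` and the atoms of the coordinates. -/
theorem exists_generic_grid {d : ℕ} (μ : Measure (Fin d → ℝ)) [IsProbabilityMeasure μ] (δ : ℝ) :
    ∃ c : ℝ, ∀ k : ℤ, c + k * δ ≠ 0 ∧ ∀ i, μ {x | x i = c + k * δ} = 0 := by
  have h1 : ∀ i : Fin d, {t : ℝ | 0 < μ {x | x i = t}}.Countable := fun i =>
    Measure.countable_meas_level_set_pos (measurable_pi_apply i)
  have h2 : (⋃ k : ℤ, (fun c : ℝ => c + k * δ) ⁻¹' ({0} ∪ ⋃ i, {t : ℝ | 0 < μ {x | x i = t}})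
      ).Countable := Set.countable_iUnion fun k =>
    ((Set.countable_singleton (0 : ℝ)).union (Set.countable_iUnion h1)).preimage
      (add_left_injective _)
  obtain ⟨c, hc⟩ := (h2.dense_compl ℝ).nonempty
  refine ⟨c, fun k => ?_⟩
  have h3 : c + k * δ ∉ ({0} ∪ ⋃ i, {t : ℝ | 0 < μ {x | x i = t}} : Set ℝ) := fun h =>
    hc (Set.mem_iUnion.2 ⟨k, h⟩)
  simp only [Set.mem_union, Set.mem_singleton_iff, Set.mem_iUnion, Set.mem_ofPred_eq, not_or,
    not_exists, not_lt, nonpos_iff_eq_zero] at h3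
  exact h3

/-- Inclusion–exclusion, one coordinate at a time: convergence of the masses of lower orthants with
corners in a grid gives convergence of the masses of the grid cells. -/
theorem tendsto_measure_gridCell {d : ℕ} {μ : ℕ → Measure (Fin d → ℝ)} {ν : Measure (Fin d → ℝ)}
    [∀ n, IsProbabilityMeasure (μ n)] [IsProbabilityMeasure ν] {c δ : ℝ} (hδ : 0 < δ)
    (h : ∀ k : Fin d → ℤ, Tendsto (fun n => μ n (Set.Iic fun i => c + k i * δ)) atTop
      (𝓝 (ν (Set.Iic fun i => c + k i * δ)))) (k : Fin d → ℤ) :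
    Tendsto (fun n => μ n (gridCell c δ k)) atTop (𝓝 (ν (gridCell c δ k))) := by
  have key : ∀ (s : Finset (Fin d)) (l k : Fin d → ℤ), (∀ i, l i ≤ k i) →
      Tendsto (fun n => μ n {x | (∀ i, x i ≤ c + k i * δ) ∧ ∀ i ∈ s, c + l i * δ < x i}) atTop
        (𝓝 (ν {x | (∀ i, x i ≤ c + k i * δ) ∧ ∀ i ∈ s, c + l i * δ < x i})) := by
    intro s
    induction s using Finset.induction_on with
    | empty =>
      intro l k _
      have : {x : Fin d → ℝ | (∀ i, x i ≤ c + k i * δ) ∧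
          ∀ i ∈ (∅ : Finset (Fin d)), c + l i * δ < x i} = Set.Iic fun i => c + k i * δ := by
        ext x; simp [Pi.le_def]
      simpa only [this] using h k
    | insert j s hj ih =>
      intro l k hlk
      have hlk' : ∀ i, l i ≤ Function.update k j (l j) i := fun i => by
        rcases eq_or_ne i j with rfl | hi
        · simp
        · simpa [hi] using hlk i
      set S : (Fin d → ℤ) → Set (Fin d → ℝ) := fun k =>
        {x | (∀ i, x i ≤ c + k i * δ) ∧ ∀ i ∈ s, c + l i * δ < x i} with hS
      have hsub : S (Function.update k j (l j)) ⊆ S k := fun x hx => ⟨fun i => by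
        refine (hx.1 i).trans ?_
        rcases eq_or_ne i j with rfl | hi
        · have : (l i : ℝ) ≤ k i := by exact_mod_cast hlk i
          simpa using mul_le_mul_of_nonneg_right this hδ.le
        · simp [hi], hx.2⟩
      have heq : {x : Fin d → ℝ | (∀ i, x i ≤ c + k i * δ) ∧
          ∀ i ∈ insert j s, c + l i * δ < x i} = S k \ S (Function.update k j (l j)) := by
        ext x
        simp only [hS, Set.mem_ofPred_eq, Finset.forall_mem_insert, Set.mem_sdiff, not_and]
        constructor
        · rintro ⟨h1, h2, h3⟩
          exact ⟨⟨h1, h3⟩, fun h4 => absurd (h4 j) (by simpa using h2)⟩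
        · rintro ⟨⟨h1, h3⟩, h4⟩
          refine ⟨h1, ?_, h3⟩
          by_contra h5
          refine h4 (fun i => ?_) h3
          rcases eq_or_ne i j with rfl | hi
          · simpa using h5
          · simpa [hi] using h1 i
      have hmeas : ∀ k, MeasurableSet (S k) := fun k => by
        have : S k = (⋂ i, (fun x : Fin d → ℝ => x i) ⁻¹' Set.Iic (c + k i * δ)) ∩
            ⋂ i ∈ s, (fun x : Fin d → ℝ => x i) ⁻¹' Set.Ioi (c + l i * δ) := by
          ext x; simp [hS]
        rw [this]
        exact (MeasurableSet.iInter fun i => measurable_pi_apply i measurableSet_Iic).inter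
          (Finset.measurableSet_biInter s fun i _ => measurable_pi_apply i measurableSet_Ioi)
      simp only [heq]
      simp only [measure_sdiff hsub (hmeas _).nullMeasurableSet (measure_ne_top _ _)]
      exact ENNReal.Tendsto.sub (ih l k hlk) (ih l _ hlk') (Or.inl (measure_ne_top _ _))
  have heq : gridCell c δ k = {x | (∀ i, x i ≤ c + k i * δ) ∧
      ∀ i ∈ Finset.univ, c + ((fun i => k i - 1 : Fin d → ℤ) i) * δ < x i} := by
    ext x
    rw [mem_gridCell_iff hδ]
    simp only [Set.mem_ofPred_eq, Finset.mem_univ, true_imp_iff, forall_and, and_comm]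
  rw [heq]
  exact key Finset.univ _ k fun i => by simp

/-- Rounding down to the lower corners of a grid of mesh `δ` loses at most `d δ` of the mean. -/
theorem lintegral_sum_le_tsum_gridCell {d : ℕ} (ν : Measure (Fin d → ℝ)) [IsProbabilityMeasure ν]
    (c : ℝ) {δ : ℝ} (hδ : 0 < δ) :
    ∫⁻ x, ENNReal.ofReal (∑ i, x i) ∂ν ≤
      ∑' k : Fin d → ℤ, ENNReal.ofReal (∑ i, max (c + (k i - 1 : ℤ) * δ) 0) * ν (gridCell c δ k) +
        ENNReal.ofReal (d * δ) := by
  have hU : (⋃ k : Fin d → ℤ, gridCell c δ k) = Set.univ :=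
    Set.eq_univ_of_forall fun x => Set.mem_iUnion.2 ⟨fun i => ⌈(x i - c) / δ⌉, fun i => rfl⟩
  have hm : ∀ k : Fin d → ℤ, MeasurableSet (gridCell c δ k) := measurableSet_gridCell c δ
  have hone : ∑' k : Fin d → ℤ, ν (gridCell c δ k) = 1 := by
    rw [← measure_iUnion (pairwise_disjoint_gridCell c δ) hm, hU, measure_univ]
  calc ∫⁻ x, ENNReal.ofReal (∑ i, x i) ∂ν
      = ∑' k : Fin d → ℤ, ∫⁻ x in gridCell c δ k, ENNReal.ofReal (∑ i, x i) ∂ν := by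
        rw [← lintegral_iUnion hm (pairwise_disjoint_gridCell c δ), hU, Measure.restrict_univ]
    _ ≤ ∑' k : Fin d → ℤ, (ENNReal.ofReal (∑ i, max (c + (k i - 1 : ℤ) * δ) 0) +
          ENNReal.ofReal (d * δ)) * ν (gridCell c δ k) := by
        refine ENNReal.tsum_le_tsum fun k => ?_
        rw [← setLIntegral_const]
        refine setLIntegral_mono measurable_const fun x hx => ?_
        rw [← ENNReal.ofReal_add (Finset.sum_nonneg fun i _ => le_max_right _ _) (by positivity)]
        refine ENNReal.ofReal_le_ofReal ?_
        have : (d : ℝ) * δ = ∑ _i : Fin d, δ := by simp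
        rw [this, ← Finset.sum_add_distrib]
        refine Finset.sum_le_sum fun i _ => ?_
        have h1 := ((mem_gridCell_iff hδ).1 hx i).2
        have h2 := le_max_left (c + (k i - 1 : ℤ) * δ) 0
        push_cast at h2 ⊢
        linarith
    _ = _ := by
        simp only [add_mul]
        rw [ENNReal.tsum_add, ENNReal.tsum_mul_left (a := ENNReal.ofReal (d * δ)), hone, mul_one]

/-- Convergence of the distribution functions at the points without null coordinates that are not
atoms of the limit marginals, together with convergence of the means, implies convergence in the
Wasserstein distance, for distributions on the nonnegative orthant. -/
theorem tendsto_wassersteinDist_of_tendsto_Iic {d : ℕ} {F : ℕ → (Fin d → ℝ) → ℝ}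
    {F₀ : (Fin d → ℝ) → ℝ} (hF : ∀ n, IsDF (F n)) (hF₀ : IsDF F₀)
    (hpos : ∀ n, ∀ i, ∀ᵐ x ∂law (F n), 0 ≤ x i) (hpos₀ : ∀ i, ∀ᵐ x ∂law F₀, 0 ≤ x i)
    (hfin : ∫⁻ x, ENNReal.ofReal (∑ i, x i) ∂law F₀ ≠ ∞)
    (hmean : Tendsto (fun n => ∫⁻ x, ENNReal.ofReal (∑ i, x i) ∂law (F n)) atTop
      (𝓝 (∫⁻ x, ENNReal.ofReal (∑ i, x i) ∂law F₀)))
    (hIic : ∀ a : Fin d → ℝ, (∀ i, a i ≠ 0 ∧ law F₀ {x | x i = a i} = 0) →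
      Tendsto (fun n => law (F n) (Set.Iic a)) atTop (𝓝 (law F₀ (Set.Iic a)))) :
    Tendsto (fun n => wassersteinDist (F n) F₀) atTop (𝓝 0) := by
  have _ := fun n => (hasDF_law (hF n)).1
  have _ := (hasDF_law hF₀).1
  rw [ENNReal.tendsto_nhds_zero]
  intro ε hε
  rcases eq_or_ne ε ∞ with rfl | hε'
  · simp
  -- The limiting bound below is `2 (A - S)` with `A` the mean and `S` a finite part of its
  -- discretisation, so `S` has to exceed `A - ε / 4`.
  obtain ⟨δ, hδ, hδε⟩ : ∃ δ : ℝ, 0 < δ ∧ ENNReal.ofReal (d * δ) < ε / 4 := by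
    have h4 : ε / 4 ≠ ∞ := ENNReal.div_ne_top hε' (by norm_num)
    have h0 : 0 < (ε / 4).toReal := ENNReal.toReal_pos (by simp [hε.ne']) h4
    refine ⟨(ε / 4).toReal / (d + 1), by positivity, (ENNReal.ofReal_lt_iff_lt_toReal
      (by positivity) h4).2 ?_⟩
    rw [mul_div_assoc', div_lt_iff₀ (by positivity)]
    nlinarith
  obtain ⟨c, hc⟩ := exists_generic_grid (law F₀) δ
  set C : (Fin d → ℤ) → ℝ≥0∞ := fun k => ENNReal.ofReal (∑ i, max (c + (k i - 1 : ℤ) * δ) 0)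
  set A : ℝ≥0∞ := ∫⁻ x, ENNReal.ofReal (∑ i, x i) ∂law F₀
  obtain ⟨K, hK⟩ : ∃ K : Finset (Fin d → ℤ),
      A ≤ ∑ k ∈ K, C k * law F₀ (gridCell c δ k) + ε / 4 := by
    rcases le_or_gt A (ε / 4) with h | h
    · exact ⟨∅, by simpa using h⟩
    have h1 : A < ∑' k, C k * law F₀ (gridCell c δ k) + ε / 4 := by
      by_cases hT : ∑' k, C k * law F₀ (gridCell c δ k) = ∞
      · simpa [hT] using hfin.lt_top
      · exact (lintegral_sum_le_tsum_gridCell (law F₀) c hδ).trans_lt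
          (ENNReal.add_lt_add_left hT hδε)
    have h2 : A - ε / 4 < ∑' k, C k * law F₀ (gridCell c δ k) := ENNReal.sub_lt_of_lt_add h.le h1
    rw [ENNReal.tsum_eq_iSup_sum] at h2
    obtain ⟨K, hK⟩ := lt_iSup_iff.1 h2
    exact ⟨K, tsub_le_iff_right.1 hK.le⟩
  have hcell : ∀ k : Fin d → ℤ, Tendsto (fun n => law (F n) (gridCell c δ k)) atTop
      (𝓝 (law F₀ (gridCell c δ k))) := fun k =>
    tendsto_measure_gridCell hδ (fun k => hIic _ fun i => ⟨(hc (k i)).1, (hc (k i)).2 i⟩) k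
  have hbound : ∀ n, wassersteinDist (F n) F₀ ≤
      ((∫⁻ x, ENNReal.ofReal (∑ i, x i) ∂law (F n)) + A) -
        2 * ∑ k ∈ K, C k * min (law (F n) (gridCell c δ k)) (law F₀ (gridCell c δ k)) := by
    intro n
    obtain ⟨π, hπ, hπK⟩ := exists_coupling_diagonal_cells K (law (F n)) (law F₀) (gridCell c δ)
      (measurableSet_gridCell c δ) (pairwise_disjoint_gridCell c δ)
    have hae : ∀ᵐ z ∂π, (∀ i, 0 ≤ z.1 i) ∧ ∀ i, 0 ≤ z.2 i := by
      have h1 := ae_of_ae_map measurable_fst.aemeasurable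
        (hπ.1.symm ▸ ae_all_iff.2 (hpos n) : ∀ᵐ x ∂π.map Prod.fst, ∀ i, 0 ≤ x i)
      have h2 := ae_of_ae_map measurable_snd.aemeasurable
        (hπ.2.symm ▸ ae_all_iff.2 hpos₀ : ∀ᵐ x ∂π.map Prod.snd, ∀ i, 0 ≤ x i)
      filter_upwards [h1, h2] with z h1 h2 using ⟨h1, h2⟩
    have h := lintegral_cost_add_le K π hae (gridCell c δ) (measurableSet_gridCell c δ)
      (pairwise_disjoint_gridCell c δ) (fun k i => c + (k i - 1 : ℤ) * δ)
      (fun k x hx i => ((mem_gridCell_iff hδ).1 hx i).1.le)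
    have e1 : ∫⁻ z, ENNReal.ofReal (∑ i, z.1 i) ∂π =
        ∫⁻ x, ENNReal.ofReal (∑ i, x i) ∂law (F n) := by
      rw [← hπ.1, lintegral_map (by fun_prop) measurable_fst]
    have e2 : ∫⁻ z, ENNReal.ofReal (∑ i, z.2 i) ∂π = A := by
      simp only [A]
      rw [← hπ.2, lintegral_map (by fun_prop) measurable_snd]
    rw [e1, e2] at h
    have hle : 2 * ∑ k ∈ K, C k * min (law (F n) (gridCell c δ k)) (law F₀ (gridCell c δ k)) ≤
        2 * ∑ k ∈ K, C k * π (gridCell c δ k ×ˢ gridCell c δ k) := by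
      gcongr with k hk
      exact hπK k hk
    refine (iInf₂_le π hπ).trans (ENNReal.le_sub_of_add_le_right ?_
      ((add_le_add_right hle _).trans h))
    refine ENNReal.mul_ne_top (by norm_num) (ENNReal.sum_ne_top.2 fun k _ => ?_)
    exact ENNReal.mul_ne_top ENNReal.ofReal_ne_top
      ((min_le_left _ _).trans_lt (measure_lt_top _ _)).ne
  have hS : Tendsto (fun n => 2 * ∑ k ∈ K, C k *
      min (law (F n) (gridCell c δ k)) (law F₀ (gridCell c δ k))) atTop
      (𝓝 (2 * ∑ k ∈ K, C k * law F₀ (gridCell c δ k))) := by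
    refine ENNReal.Tendsto.const_mul (tendsto_finsetSum K fun k _ => ?_) (Or.inr (by norm_num))
    refine ENNReal.Tendsto.const_mul ?_ (Or.inr ENNReal.ofReal_ne_top)
    simpa using (hcell k).min (tendsto_const_nhds (x := law F₀ (gridCell c δ k)))
  have hlim := ENNReal.Tendsto.sub (hmean.add_const A) hS
    (Or.inl (ENNReal.add_ne_top.2 ⟨hfin, hfin⟩))
  have hlt : A + A - 2 * ∑ k ∈ K, C k * law F₀ (gridCell c δ k) < ε := by
    refine lt_of_le_of_lt ?_ (ENNReal.half_lt_self hε.ne' hε')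
    rw [tsub_le_iff_right]
    calc A + A ≤ _ := add_le_add hK hK
      _ = (ε / 4 + ε / 4) + 2 * ∑ k ∈ K, C k * law F₀ (gridCell c δ k) := by ring
      _ = _ := by
        rw [ENNReal.div_add_div_same, ← two_mul, show (4 : ℝ≥0∞) = 2 * 2 by norm_num,
        ENNReal.mul_div_mul_left _ _ (by norm_num) (by norm_num)]
  filter_upwards [hlim.eventually (gt_mem_nhds hlt)] with n hn
  exact (hbound n).trans hn.le

/-! ### Convergence of norms and Hausdorff convergence of their unit spheres -/

/-- On a finite-dimensional space every norm dominates every seminorm. -/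
theorem exists_seminorm_le_mul {E : Type*} [NormedAddCommGroup E] [NormedSpace ℝ E]
    [FiniteDimensional ℝ E] (p q : Seminorm ℝ E) (hq : ∀ x, q x = 0 → x = 0) :
    ∃ C : ℝ, 0 < C ∧ ∀ x, p x ≤ C * q x := by
  have hcont : ∀ r : Seminorm ℝ E, Continuous r := fun r =>
    continuousOn_univ.1 (r.convexOn.continuousOn isOpen_univ)
  obtain ⟨A, hA, hpA⟩ := Seminorm.bound_of_continuous_normedSpace p (hcont p)
  rcases subsingleton_or_nontrivial E with hE | hE
  · exact ⟨1, one_pos, fun x => by simp [Subsingleton.elim x 0]⟩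
  obtain ⟨v, hv, hmin⟩ := (isCompact_sphere (0 : E) 1).exists_isMinOn
    (NormedSpace.sphere_nonempty.2 zero_le_one) (hcont q).continuousOn
  have hv0 : v ≠ 0 := fun h => by simp [h] at hv
  have hqv : 0 < q v := lt_of_le_of_ne (apply_nonneg q v) fun h => hv0 (hq v h.symm)
  refine ⟨A / q v, by positivity, fun x => ?_⟩
  rcases eq_or_ne x 0 with rfl | hx
  · simp
  have hx' : 0 < ‖x‖ := norm_pos_iff.2 hx
  have h : q v ≤ q (‖x‖⁻¹ • x) := hmin (by simp [norm_smul, hx'.ne'])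
  rw [map_smul_eq_mul, norm_inv, norm_norm, le_inv_mul_iff₀ hx'] at h
  calc p x ≤ A * ‖x‖ := hpA x
    _ = A / q v * (‖x‖ * q v) := by field_simp
    _ ≤ A / q v * q x := by gcongr

/-- A point at which the seminorm `r` is nearly `1` is near the unit sphere of `r`: rescale it. -/
theorem exists_mem_sphere_near {E : Type*} [AddCommGroup E] [Module ℝ E] (p r : Seminorm ℝ E)
    {x : E} {C η : ℝ} (hη : η ≤ 1 / 2) (hp : p x ≤ C) (hr : |r x - 1| ≤ η) :
    ∃ y, r y = 1 ∧ p (x - y) ≤ 2 * C * η := by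
  have h1 := abs_le.1 hr
  have hr0 : 1 / 2 ≤ r x := by linarith
  have hr1 : 0 < r x := by linarith
  have hη0 : 0 ≤ η := (abs_nonneg _).trans hr
  have hC : 0 ≤ C := (apply_nonneg p x).trans hp
  refine ⟨(r x)⁻¹ • x, ?_, ?_⟩
  · rw [map_smul_eq_mul, norm_inv, Real.norm_of_nonneg hr1.le, inv_mul_cancel₀ hr1.ne']
  · have h2 : x - (r x)⁻¹ • x = (1 - (r x)⁻¹) • x := by rw [sub_smul, one_smul]
    have h3 : |1 - (r x)⁻¹| ≤ 2 * η := by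
      have h4 : 1 - (r x)⁻¹ = (r x - 1) / r x := by field_simp
      rw [h4, abs_div, abs_of_pos hr1, div_le_iff₀ hr1]
      nlinarith
    rw [h2, map_smul_eq_mul, Real.norm_eq_abs]
    calc |1 - (r x)⁻¹| * p x ≤ (2 * η) * C := by gcongr
      _ = 2 * C * η := by ring

/-- Seminorms that converge uniformly on the unit sphere of a norm have unit spheres converging in
the Hausdorff distance. -/
theorem tendsto_hausdorffDistOf_sphere {E : Type*} [NormedAddCommGroup E] [NormedSpace ℝ E]
    [FiniteDimensional ℝ E] (p : Seminorm ℝ E) (N : ℕ → Seminorm ℝ E) (N₀ : Seminorm ℝ E)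
    (hN₀ : ∀ x, N₀ x = 0 → x = 0)
    (h : ∀ ε > 0, ∀ᶠ n in atTop, ∀ x, |N n x - N₀ x| ≤ ε * N₀ x) :
    Tendsto (fun n => hausdorffDistOf p {x | N n x = 1} {x | N₀ x = 1}) atTop (𝓝 0) := by
  obtain ⟨C, hC, hpC⟩ := exists_seminorm_le_mul p N₀ hN₀
  rw [ENNReal.tendsto_nhds_zero]
  intro ε hε
  rcases eq_or_ne ε ∞ with rfl | hε'
  · simp
  have hε0 : 0 < ε.toReal := ENNReal.toReal_pos hε.ne' hε'
  obtain ⟨η, hη, hη4, hηε⟩ : ∃ η : ℝ, 0 < η ∧ η ≤ 1 / 4 ∧ 8 * C * η ≤ ε.toReal :=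
    ⟨min (1 / 4) (ε.toReal / (8 * C)), by positivity, min_le_left _ _, by
      rw [mul_comm, ← le_div_iff₀ (by positivity)]
      exact min_le_right _ _⟩
  filter_upwards [h η hη] with n hn
  refine max_le (iSup₂_le fun y hy => ?_) (iSup₂_le fun x hx => ?_)
  · have hy1 : N₀ y = 1 := hy
    obtain ⟨x, hx, hxy⟩ := exists_mem_sphere_near p (N n) (x := y) (C := C) (η := η) (by linarith)
      (by simpa [hy1] using hpC y) (by simpa [hy1] using hn y)
    refine (iInf₂_le x hx).trans (ENNReal.ofReal_le_of_le_toReal ?_)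
    rw [map_sub_rev]
    exact hxy.trans (by nlinarith)
  · have hx1 : N n x = 1 := hx
    have hnx := hn x
    rw [hx1] at hnx
    -- On the sphere of `N n` the norm `N₀` is at most `2`.
    have h2 : N₀ x ≤ 2 := by
      have := (abs_le.1 hnx).1
      nlinarith [apply_nonneg N₀ x]
    obtain ⟨y, hy, hxy⟩ := exists_mem_sphere_near p N₀ (x := x) (C := 2 * C) (η := 2 * η)
      (by linarith) ((hpC x).trans (by nlinarith)) (by rw [abs_sub_comm]; nlinarith)
    refine (iInf₂_le y hy).trans (ENNReal.ofReal_le_of_le_toReal (hxy.trans ?_))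
    linarith

/-- Hausdorff convergence of the unit spheres of norms implies pointwise convergence of the norms.
The spheres stay away from the origin, which bounds `N n` by a multiple of `p` uniformly in `n`;
hence `N n` is nearly `1` at the points of the limit sphere, each being near the sphere of `N n`. -/
theorem tendsto_of_tendsto_hausdorffDistOf_sphere {E : Type*} [NormedAddCommGroup E]
    [NormedSpace ℝ E] [FiniteDimensional ℝ E] (p : Seminorm ℝ E) (hp : ∀ x, p x = 0 → x = 0)
    (N : ℕ → Seminorm ℝ E) (N₀ : Seminorm ℝ E) (hN : ∀ n x, N n x = 0 → x = 0)
    (hN₀ : ∀ x, N₀ x = 0 → x = 0)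
    (h : Tendsto (fun n => hausdorffDistOf p {x | N n x = 1} {x | N₀ x = 1}) atTop (𝓝 0)) (x : E) :
    Tendsto (fun n => N n x) atTop (𝓝 (N₀ x)) := by
  have hpos : ∀ q : Seminorm ℝ E, (∀ x, q x = 0 → x = 0) → ∀ x, x ≠ 0 → 0 < q x :=
    fun q hq x hx => lt_of_le_of_ne (apply_nonneg q x) fun h => hx (hq x h.symm)
  have hnormal : ∀ q : Seminorm ℝ E, (∀ x, q x = 0 → x = 0) → ∀ x, x ≠ 0 →
      q ((q x)⁻¹ • x) = 1 := fun q hq x hx => by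
    rw [map_smul_eq_mul, norm_inv, Real.norm_of_nonneg (apply_nonneg q x),
      inv_mul_cancel₀ (hpos q hq x hx).ne']
  obtain ⟨C, hC, hNp⟩ := exists_seminorm_le_mul N₀ p hp
  have hdist : ∀ η : ℝ, 0 < η → ∀ᶠ n in atTop,
      (∀ y, N₀ y = 1 → ∃ x, N n x = 1 ∧ p (x - y) < η) ∧
        ∀ x, N n x = 1 → ∃ y, N₀ y = 1 ∧ p (x - y) < η := by
    intro η hη
    filter_upwards [h.eventually (gt_mem_nhds (ENNReal.ofReal_pos.2 hη))] with n hn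
    obtain ⟨h1, h2⟩ := max_lt_iff.1 hn
    constructor
    · intro y hy
      obtain ⟨x, hx⟩ := iInf_lt_iff.1 ((le_iSup₂ (f := fun y (_ : y ∈ {x | N₀ x = 1}) =>
        ⨅ x ∈ {x | N n x = 1}, ENNReal.ofReal (p (x - y))) y hy).trans_lt h1)
      obtain ⟨hx1, hx2⟩ := iInf_lt_iff.1 hx
      exact ⟨x, hx1, (ENNReal.ofReal_lt_ofReal_iff hη).1 hx2⟩
    · intro x hx
      obtain ⟨y, hy⟩ := iInf_lt_iff.1 ((le_iSup₂ (f := fun x (_ : x ∈ {x | N n x = 1}) =>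
        ⨅ y ∈ {x | N₀ x = 1}, ENNReal.ofReal (p (x - y))) x hx).trans_lt h2)
      obtain ⟨hy1, hy2⟩ := iInf_lt_iff.1 hy
      exact ⟨y, hy1, (ENNReal.ofReal_lt_ofReal_iff hη).1 hy2⟩
  -- `p ≥ 1 / C` on the limit sphere, hence `p ≥ 1 / (2 C)` on the sphere of `N n`.
  have hbound : ∀ᶠ n in atTop, ∀ v, N n v ≤ 2 * C * p v := by
    filter_upwards [hdist (1 / (2 * C)) (by positivity)] with n hn v
    rcases eq_or_ne v 0 with rfl | hv
    · simp
    have hv0 := hpos (N n) (hN n) v hv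
    obtain ⟨y, hy, hvy⟩ := hn.2 _ (hnormal (N n) (hN n) v hv)
    have h1 : 1 ≤ C * p y := hy ▸ hNp y
    have h2 : p y ≤ p ((N n v)⁻¹ • v) + p ((N n v)⁻¹ • v - y) := by
      linarith [(abs_le.1 (abs_sub_map_le_sub p ((N n v)⁻¹ • v) y)).1]
    rw [map_smul_eq_mul, norm_inv, Real.norm_of_nonneg hv0.le] at h2
    have h3 : 1 ≤ C * ((N n v)⁻¹ * p v) + 1 / 2 := by
      have h4 : C * p ((N n v)⁻¹ • v - y) ≤ 1 / 2 := by
        calc _ ≤ C * (1 / (2 * C)) := by gcongr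
          _ = 1 / 2 := by field_simp
      nlinarith
    have h5 : 1 / 2 ≤ C * p v / N n v := by
      rw [show C * p v / N n v = C * ((N n v)⁻¹ * p v) by ring]
      linarith
    rw [le_div_iff₀ hv0] at h5
    linarith
  rcases eq_or_ne x 0 with rfl | hx
  · simp
  have hx0 := hpos N₀ hN₀ x hx
  set u := (N₀ x)⁻¹ • x with hu
  have hu1 : Tendsto (fun n => N n u) atTop (𝓝 1) := by
    rw [Metric.tendsto_nhds]
    intro ε hε
    filter_upwards [hbound, hdist (ε / (2 * C)) (by positivity)] with n hn1 hn2
    obtain ⟨y, hy, hyu⟩ := hn2.1 u (hnormal N₀ hN₀ x hx)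
    rw [Real.dist_eq, ← hy, abs_sub_comm]
    calc |N n y - N n u| ≤ N n (y - u) := abs_sub_map_le_sub _ _ _
      _ ≤ 2 * C * p (y - u) := hn1 _
      _ < 2 * C * (ε / (2 * C)) := by gcongr
      _ = ε := by field_simp
  have hxu : ∀ n, N n x = N₀ x * N n u := fun n => by
    rw [hu, map_smul_eq_mul, norm_inv, Real.norm_of_nonneg hx0.le, mul_inv_cancel_left₀ hx0.ne']
  simp only [hxu]
  simpa using hu1.const_mul (N₀ x)

/-! ### The `F`-norm -/

/-- The integrand of the `F`-norm: the maximum of `|x₀|` and the `|x_i| X_i`. -/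
noncomputable def maxForm {d : ℕ} (x : Fin (d + 1) → ℝ) (X : Fin d → ℝ) : ℝ :=
  max |x 0| (⨆ i : Fin d, |x i.succ| * X i)

theorem maxForm_le_iff {d : ℕ} {x : Fin (d + 1) → ℝ} {X : Fin d → ℝ} {c : ℝ} :
    maxForm x X ≤ c ↔ |x 0| ≤ c ∧ ∀ i : Fin d, |x i.succ| * X i ≤ c := by
  rw [maxForm, max_le_iff]
  refine and_congr_right fun h => ⟨fun h' i => ?_, fun h' => ?_⟩
  · exact (le_ciSup (Set.finite_range fun i : Fin d => |x i.succ| * X i).bddAbove i).trans h'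
  -- The bound `0 ≤ c` takes care of the empty supremum, which is `0`.
  · exact Real.iSup_le h' ((abs_nonneg _).trans h)

theorem abs_zero_le_maxForm {d : ℕ} (x : Fin (d + 1) → ℝ) (X : Fin d → ℝ) : |x 0| ≤ maxForm x X :=
  (maxForm_le_iff.1 le_rfl).1

theorem abs_succ_mul_le_maxForm {d : ℕ} (x : Fin (d + 1) → ℝ) (X : Fin d → ℝ) (i : Fin d) :
    |x i.succ| * X i ≤ maxForm x X :=
  (maxForm_le_iff.1 le_rfl).2 i

theorem maxForm_nonneg {d : ℕ} (x : Fin (d + 1) → ℝ) (X : Fin d → ℝ) : 0 ≤ maxForm x X :=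
  (abs_nonneg _).trans (abs_zero_le_maxForm x X)

theorem measurable_maxForm {d : ℕ} (x : Fin (d + 1) → ℝ) : Measurable (maxForm x) :=
  measurable_const.max (Measurable.iSup fun i => (measurable_pi_apply i).const_mul _)

theorem maxForm_le_add_sum {d : ℕ} (x : Fin (d + 1) → ℝ) (X Y : Fin d → ℝ) :
    maxForm x X ≤ maxForm x Y + ‖x‖ * ∑ i, |X i - Y i| := by
  refine maxForm_le_iff.2 ⟨?_, fun i => ?_⟩
  · have := abs_zero_le_maxForm x Y
    have : 0 ≤ ‖x‖ * ∑ i, |X i - Y i| := by positivity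
    linarith
  · have h1 := abs_succ_mul_le_maxForm x Y i
    have h2 : |x i.succ| * |X i - Y i| ≤ ‖x‖ * ∑ i, |X i - Y i| :=
      mul_le_mul (norm_le_pi_norm x i.succ)
        (Finset.single_le_sum (f := fun i => |X i - Y i|) (fun _ _ => abs_nonneg _)
          (Finset.mem_univ i)) (abs_nonneg _) (norm_nonneg x)
    have h3 : |x i.succ| * (X i - Y i) ≤ |x i.succ| * |X i - Y i| :=
      mul_le_mul_of_nonneg_left (le_abs_self _) (abs_nonneg _)
    linarith

theorem abs_maxForm_sub_le {d : ℕ} (x : Fin (d + 1) → ℝ) (X Y : Fin d → ℝ) :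
    |maxForm x X - maxForm x Y| ≤ ‖x‖ * ∑ i, |X i - Y i| := by
  have h1 := maxForm_le_add_sum x X Y
  have h2 := maxForm_le_add_sum x Y X
  simp only [abs_sub_comm (Y _)] at h2
  rw [abs_le]
  constructor <;> linarith

theorem ConditionH.isProbabilityMeasure {d : ℕ} {F : (Fin d → ℝ) → ℝ} (hF : ConditionH F) :
    IsProbabilityMeasure (law F) :=
  (hasDF_law hF.1).1

theorem ConditionH.ae_nonneg {d : ℕ} {F : (Fin d → ℝ) → ℝ} (hF : ConditionH F) :
    ∀ᵐ X ∂law F, ∀ i, 0 ≤ X i :=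
  ae_all_iff.2 fun i => (hF.2 i).1

theorem ConditionH.integrable_maxForm {d : ℕ} {F : (Fin d → ℝ) → ℝ} (hF : ConditionH F)
    (x : Fin (d + 1) → ℝ) : Integrable (maxForm x) (law F) := by
  have := hF.isProbabilityMeasure
  have h : Integrable (fun X : Fin d → ℝ => |x 0| + ‖x‖ * ∑ i, |X i - 0|) (law F) :=
    (integrable_const _).add ((integrable_finsetSum _ fun i _ => by
      simpa using (hF.2 i).2.1.abs).const_mul _)
  refine h.mono' (measurable_maxForm x).aestronglyMeasurable (ae_of_all _ fun X => ?_)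
  rw [Real.norm_of_nonneg (maxForm_nonneg x X)]
  have h0 : maxForm x (0 : Fin d → ℝ) ≤ |x 0| :=
    maxForm_le_iff.2 ⟨le_rfl, fun i => by simp⟩
  have := maxForm_le_add_sum x X 0
  simp only [Pi.zero_apply] at this
  linarith

/-- The `F`-norm as a seminorm. -/
noncomputable def fSeminorm {d : ℕ} {F : (Fin d → ℝ) → ℝ} (hF : ConditionH F) :
    Seminorm ℝ (Fin (d + 1) → ℝ) :=
  Seminorm.of (fNorm F)
    (fun x y => by
      change ∫ X, maxForm (x + y) X ∂law F ≤ ∫ X, maxForm x X ∂law F + ∫ X, maxForm y X ∂law F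
      rw [← integral_add (hF.integrable_maxForm x) (hF.integrable_maxForm y)]
      refine integral_mono_ae (hF.integrable_maxForm _)
        ((hF.integrable_maxForm x).add (hF.integrable_maxForm y)) ?_
      filter_upwards [hF.ae_nonneg] with X hX
      refine maxForm_le_iff.2 ⟨?_, fun i => ?_⟩
      · exact (abs_add_le _ _).trans
          (add_le_add (abs_zero_le_maxForm x X) (abs_zero_le_maxForm y X))
      · calc |(x + y) i.succ| * X i ≤ (|x i.succ| + |y i.succ|) * X i :=
            mul_le_mul_of_nonneg_right (abs_add_le _ _) (hX i)
          _ = |x i.succ| * X i + |y i.succ| * X i := add_mul _ _ _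
          _ ≤ _ := add_le_add (abs_succ_mul_le_maxForm x X i) (abs_succ_mul_le_maxForm y X i))
    (fun c x => by
      change ∫ X, maxForm (c • x) X ∂law F = ‖c‖ * ∫ X, maxForm x X ∂law F
      rw [← integral_const_mul]
      refine integral_congr_ae (ae_of_all _ fun X => ?_)
      simp only [maxForm, Pi.smul_apply, smul_eq_mul, abs_mul, mul_assoc, Real.norm_eq_abs]
      rw [mul_max_of_nonneg _ _ (abs_nonneg c), Real.mul_iSup_of_nonneg (abs_nonneg c)])

/-- The `F`-norm is definite because it dominates `|x₀|` and `|x_i| E X_i`. -/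
theorem eq_zero_of_fSeminorm_eq_zero {d : ℕ} {F : (Fin d → ℝ) → ℝ} (hF : ConditionH F)
    (x : Fin (d + 1) → ℝ) (h : fSeminorm hF x = 0) : x = 0 := by
  have := hF.isProbabilityMeasure
  have h' : ∫ X, maxForm x X ∂law F = 0 := h
  funext j
  refine Fin.cases ?_ (fun i => ?_) j
  · have : ∫ _, |x 0| ∂law F ≤ ∫ X, maxForm x X ∂law F :=
      integral_mono (integrable_const _) (hF.integrable_maxForm x) fun X => abs_zero_le_maxForm x X
    rw [h', integral_const, probReal_univ, one_smul] at this
    exact abs_nonpos_iff.1 this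
  · have h1 : ∫ X, |x i.succ| * X i ∂law F ≤ ∫ X, maxForm x X ∂law F :=
      integral_mono ((hF.2 i).2.1.const_mul _) (hF.integrable_maxForm x) fun X =>
        abs_succ_mul_le_maxForm x X i
    rw [h', integral_const_mul] at h1
    exact abs_nonpos_iff.1 (nonpos_of_mul_nonpos_left h1 (hF.2 i).2.2)

/-- The value of the `F`-norm at the `i`-th coordinate vector is the mean of `X_i`. -/
theorem fNorm_single {d : ℕ} {F : (Fin d → ℝ) → ℝ} (hF : ConditionH F) (i : Fin d) :
    fNorm F (Pi.single i.succ 1) = ∫ X, X i ∂law F := by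
  refine integral_congr_ae ?_
  filter_upwards [hF.ae_nonneg] with X hX
  refine le_antisymm (maxForm_le_iff.2 ⟨by simpa [Pi.single_apply] using hX i, fun j => ?_⟩) ?_
  · rcases eq_or_ne j i with rfl | hj
    · simp
    · simpa [Pi.single_apply, hj] using hX i
  · have := abs_succ_mul_le_maxForm (Pi.single i.succ 1) X i
    rwa [Pi.single_eq_same, abs_one, one_mul] at this

/-- The map `F ↦ ‖x‖_F` is Lipschitz for the Wasserstein distance. -/
theorem abs_fNorm_sub_le {d : ℕ} {F G : (Fin d → ℝ) → ℝ} (hF : ConditionH F) (hG : ConditionH G)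
    {ε : ℝ} (hε : 0 < ε) (h : wassersteinDist F G < ENNReal.ofReal ε) (x : Fin (d + 1) → ℝ) :
    |fNorm F x - fNorm G x| ≤ ε * ‖x‖ := by
  obtain ⟨π, hπ⟩ := iInf_lt_iff.1 h
  obtain ⟨⟨h1, h2⟩, hcost⟩ := iInf_lt_iff.1 hπ
  have e1 : fNorm F x = ∫ z, maxForm x z.1 ∂π := by
    change ∫ X, maxForm x X ∂law F = _
    rw [← h1, integral_map measurable_fst.aemeasurable
      (measurable_maxForm x).aestronglyMeasurable]
  have e2 : fNorm G x = ∫ z, maxForm x z.2 ∂π := by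
    change ∫ X, maxForm x X ∂law G = _
    rw [← h2, integral_map measurable_snd.aemeasurable
      (measurable_maxForm x).aestronglyMeasurable]
  have i1 : Integrable (fun z : (Fin d → ℝ) × (Fin d → ℝ) => maxForm x z.1) π :=
    (h1 ▸ hF.integrable_maxForm x : Integrable (maxForm x) (π.map Prod.fst)).comp_measurable
      measurable_fst
  have i2 : Integrable (fun z : (Fin d → ℝ) × (Fin d → ℝ) => maxForm x z.2) π :=
    (h2 ▸ hG.integrable_maxForm x : Integrable (maxForm x) (π.map Prod.snd)).comp_measurable
      measurable_snd
  have hm : Measurable fun z : (Fin d → ℝ) × (Fin d → ℝ) => ∑ i, |z.1 i - z.2 i| := by fun_prop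
  have h0 : 0 ≤ᵐ[π] fun z : (Fin d → ℝ) × (Fin d → ℝ) => ∑ i, |z.1 i - z.2 i| :=
    ae_of_all _ fun z => Finset.sum_nonneg fun i _ => abs_nonneg _
  have hint : Integrable (fun z : (Fin d → ℝ) × (Fin d → ℝ) => ∑ i, |z.1 i - z.2 i|) π :=
    ⟨hm.aestronglyMeasurable, (hasFiniteIntegral_iff_ofReal h0).2
      (hcost.trans ENNReal.ofReal_lt_top)⟩
  have hle : ∫ z, ∑ i, |z.1 i - z.2 i| ∂π ≤ ε := by
    rw [integral_eq_lintegral_of_nonneg_ae h0 hm.aestronglyMeasurable]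
    exact ENNReal.toReal_le_of_le_ofReal hε.le hcost.le
  rw [e1, e2, ← integral_sub i1 i2]
  calc |∫ z, (maxForm x z.1 - maxForm x z.2) ∂π|
      ≤ ∫ z, |maxForm x z.1 - maxForm x z.2| ∂π := abs_integral_le_integral_abs
    _ ≤ ∫ z, ‖x‖ * ∑ i, |z.1 i - z.2 i| ∂π :=
        integral_mono (i1.sub i2).abs (hint.const_mul _) fun z => abs_maxForm_sub_le x z.1 z.2
    _ = ‖x‖ * ∫ z, ∑ i, |z.1 i - z.2 i| ∂π := integral_const_mul _ _
    _ ≤ ε * ‖x‖ := by rw [mul_comm]; gcongr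

/-! ### Recovering distribution functions from `F`-norms -/

/-- Integrating `u ↦ h 1{u ≤ s} ≤ max (s + h) u - max s u` against the law of the maximum `M` of the
`y_i X_i`: difference quotients of `s ↦ E (max s M)` bound `P (M ≤ s)` from above. -/
theorem mul_measureReal_le {d : ℕ} {F : (Fin d → ℝ) → ℝ} (hF : ConditionH F) (y : Fin d → ℝ)
    {s h : ℝ} (hs : 0 ≤ s) (hh : 0 ≤ h) :
    h * (law F).real {X | ∀ i, |y i| * X i ≤ s} ≤
      fNorm F (Fin.cons (s + h) y) - fNorm F (Fin.cons s y) := by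
  have := hF.isProbabilityMeasure
  change _ ≤ ∫ X, maxForm _ X ∂law F - ∫ X, maxForm _ X ∂law F
  have hm : MeasurableSet {X : Fin d → ℝ | ∀ i, |y i| * X i ≤ s} := by
    rw [Set.ofPred_forall]
    exact MeasurableSet.iInter fun i =>
      measurableSet_le ((measurable_pi_apply i).const_mul _) measurable_const
  rw [← integral_sub (hF.integrable_maxForm _) (hF.integrable_maxForm _), mul_comm,
    ← smul_eq_mul, ← integral_indicator_const h hm]
  refine integral_mono ((integrable_const h).indicator hm)
    ((hF.integrable_maxForm _).sub (hF.integrable_maxForm _)) fun X => ?_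
  by_cases hX : X ∈ {X : Fin d → ℝ | ∀ i, |y i| * X i ≤ s}
  · have h1 : maxForm (Fin.cons s y : Fin (d + 1) → ℝ) X ≤ s :=
      maxForm_le_iff.2 ⟨by simp [abs_of_nonneg hs], by simpa using hX⟩
    have h2 := abs_zero_le_maxForm (Fin.cons (s + h) y : Fin (d + 1) → ℝ) X
    rw [Fin.cons_zero, abs_of_nonneg (by linarith)] at h2
    rw [Set.indicator_of_mem hX]
    change h ≤ maxForm _ X - maxForm _ X
    linarith
  · rw [Set.indicator_of_notMem hX]
    refine sub_nonneg.2 (maxForm_le_iff.2 ⟨?_, fun i => ?_⟩)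
    · have h2 := abs_zero_le_maxForm (Fin.cons (s + h) y : Fin (d + 1) → ℝ) X
      rw [Fin.cons_zero, abs_of_nonneg (by linarith)] at h2
      rw [Fin.cons_zero, abs_of_nonneg hs]
      linarith
    · simpa using abs_succ_mul_le_maxForm (Fin.cons (s + h) y : Fin (d + 1) → ℝ) X i

/-- Difference quotients of `s ↦ E (max s M)` to the left of `s + h` bound `P (M ≤ s + h)` from
below. -/
theorem fNorm_sub_le_mul_measureReal {d : ℕ} {F : (Fin d → ℝ) → ℝ} (hF : ConditionH F)
    (y : Fin d → ℝ) {s h : ℝ} (hs : 0 ≤ s) (hh : 0 ≤ h) :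
    fNorm F (Fin.cons (s + h) y) - fNorm F (Fin.cons s y) ≤
      h * (law F).real {X | ∀ i, |y i| * X i ≤ s + h} := by
  have := hF.isProbabilityMeasure
  change ∫ X, maxForm _ X ∂law F - ∫ X, maxForm _ X ∂law F ≤ _
  have hm : MeasurableSet {X : Fin d → ℝ | ∀ i, |y i| * X i ≤ s + h} := by
    rw [Set.ofPred_forall]
    exact MeasurableSet.iInter fun i =>
      measurableSet_le ((measurable_pi_apply i).const_mul _) measurable_const
  rw [← integral_sub (hF.integrable_maxForm _) (hF.integrable_maxForm _), mul_comm,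
    ← smul_eq_mul, ← integral_indicator_const h hm]
  refine integral_mono ((hF.integrable_maxForm _).sub (hF.integrable_maxForm _))
    ((integrable_const h).indicator hm) fun X => ?_
  change maxForm _ X - maxForm _ X ≤ _
  have h2 := abs_zero_le_maxForm (Fin.cons s y : Fin (d + 1) → ℝ) X
  rw [Fin.cons_zero, abs_of_nonneg hs] at h2
  by_cases hX : X ∈ {X : Fin d → ℝ | ∀ i, |y i| * X i ≤ s + h}
  · have h1 : maxForm (Fin.cons (s + h) y : Fin (d + 1) → ℝ) X ≤ s + h :=
      maxForm_le_iff.2 ⟨by simp [abs_of_nonneg (add_nonneg hs hh)], by simpa using hX⟩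
    rw [Set.indicator_of_mem hX]
    linarith
  · rw [Set.indicator_of_notMem hX]
    obtain ⟨j, hj⟩ : ∃ j, s + h < |y j| * X j := by simpa using hX
    have h3 : ∀ i, |y i| * X i ≤ maxForm (Fin.cons s y : Fin (d + 1) → ℝ) X := fun i => by
      simpa using abs_succ_mul_le_maxForm (Fin.cons s y : Fin (d + 1) → ℝ) X i
    refine sub_nonpos.2 (maxForm_le_iff.2 ⟨?_, fun i => by simpa using h3 i⟩)
    rw [Fin.cons_zero, abs_of_nonneg (add_nonneg hs hh)]
    exact hj.le.trans (h3 j)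

/-- Pointwise convergence of the `F`-norms implies convergence of the distribution functions at
every point with nonzero coordinates none of which is an atom of the limit marginals. -/
theorem tendsto_law_Iic {d : ℕ} {F : ℕ → (Fin d → ℝ) → ℝ} {F₀ : (Fin d → ℝ) → ℝ}
    (hF : ∀ n, ConditionH (F n)) (hF₀ : ConditionH F₀)
    (h : ∀ x, Tendsto (fun n => fNorm (F n) x) atTop (𝓝 (fNorm F₀ x)))
    (a : Fin d → ℝ) (ha : ∀ i, a i ≠ 0 ∧ law F₀ {x | x i = a i} = 0) :
    Tendsto (fun n => law (F n) (Set.Iic a)) atTop (𝓝 (law F₀ (Set.Iic a))) := by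
  have _ := fun n => (hF n).isProbabilityMeasure
  have _ := hF₀.isProbabilityMeasure
  by_cases hpos : ∃ i, a i < 0
  · obtain ⟨i, hi⟩ := hpos
    have hzero : ∀ G : (Fin d → ℝ) → ℝ, ConditionH G → law G (Set.Iic a) = 0 := fun G hG => by
      refine measure_mono_null (fun X hX => ?_) (ae_iff.1 (hG.2 i).1)
      exact not_le.2 ((hX i).trans_lt hi)
    simp only [hzero _ (hF _), hzero _ hF₀, tendsto_const_nhds]
  push Not at hpos
  have hpos' : ∀ i, 0 < a i := fun i => lt_of_le_of_ne (hpos i) (ha i).1.symm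
  -- With `y_i = 1 / a_i` the orthant below `a` is `{M ≤ 1}`, where `M` is the maximum of
  -- the `y_i X_i`.
  set y : Fin d → ℝ := fun i => (a i)⁻¹ with hy
  set S : ℝ → Set (Fin d → ℝ) := fun s => {X | ∀ i, |y i| * X i ≤ s} with hS
  have hmS : ∀ s, MeasurableSet (S s) := fun s => by
    simp only [hS]
    rw [Set.ofPred_forall]
    exact MeasurableSet.iInter fun i =>
      measurableSet_le ((measurable_pi_apply i).const_mul _) measurable_const
  have hmono : Monotone S := fun s t hst X hX i => (hX i).trans hst
  have hS1 : S 1 = Set.Iic a := by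
    ext X
    refine forall_congr' fun i => ?_
    rw [abs_of_pos (inv_pos.2 (hpos' i)), inv_mul_le_iff₀ (hpos' i), mul_one]
  rw [← hS1]
  suffices hreal : Tendsto (fun n => (law (F n)).real (S 1)) atTop (𝓝 ((law F₀).real (S 1))) from
    (ENNReal.tendsto_toReal_iff (fun n => measure_ne_top _ _) (measure_ne_top _ _)).1 hreal
  -- `s ↦ P (M ≤ s)` is continuous at `1`.
  have hright : Tendsto (fun m : ℕ => (law F₀).real (S (1 + 1 / ((m : ℝ) + 2)))) atTop
      (𝓝 ((law F₀).real (S 1))) := by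
    have hInter : S 1 = ⋂ m : ℕ, S (1 + 1 / ((m : ℝ) + 2)) := by
      refine Set.Subset.antisymm (Set.subset_iInter fun m => hmono ?_) fun X hX i => ?_
      · linarith [show 0 < 1 / ((m : ℝ) + 2) by positivity]
      · have hlim : Tendsto (fun m : ℕ => 1 + 1 / ((m : ℝ) + 2)) atTop (𝓝 (1 + 0)) :=
          (tendsto_const_nhds.div_atTop
            (tendsto_atTop_add_const_right _ _ tendsto_natCast_atTop_atTop)).const_add 1
        rw [add_zero] at hlim
        exact ge_of_tendsto' hlim fun m => Set.mem_iInter.1 hX m i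
    refine (ENNReal.tendsto_toReal (measure_ne_top _ _)).comp ?_
    rw [hInter]
    refine tendsto_measure_iInter_atTop (fun m => (hmS _).nullMeasurableSet) (fun m m' hm => ?_)
      ⟨0, measure_ne_top _ _⟩
    refine hmono ?_
    have : (m : ℝ) ≤ m' := by exact_mod_cast hm
    gcongr
  have hleft : Tendsto (fun m : ℕ => (law F₀).real (S (1 - 1 / ((m : ℝ) + 2)))) atTop
      (𝓝 ((law F₀).real (S 1))) := by
    have hUnion : law F₀ (⋃ m : ℕ, S (1 - 1 / ((m : ℝ) + 2))) = law F₀ (S 1) := by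
      refine measure_congr (Filter.eventuallyLE_antisymm_iff.2 ⟨?_, ?_⟩)
      · refine LE.le.eventuallyLE (Set.iUnion_subset fun m => hmono ?_)
        linarith [show 0 < 1 / ((m : ℝ) + 2) by positivity]
      · have hne : ∀ᵐ X ∂law F₀, ∀ i, X i ≠ a i := ae_all_iff.2 fun i => by
          simpa [ae_iff] using (ha i).2
        filter_upwards [hne] with X hX hX1
        have hlt : ∀ i, |y i| * X i < 1 := fun i => by
          refine lt_of_le_of_ne (hX1 i) fun he => hX i ?_
          rwa [abs_of_pos (inv_pos.2 (hpos' i)), inv_mul_eq_iff_eq_mul₀ (hpos' i).ne',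
            mul_one] at he
        have hlim : Tendsto (fun m : ℕ => 1 - 1 / ((m : ℝ) + 2)) atTop (𝓝 (1 - 0)) :=
          (tendsto_const_nhds.div_atTop
            (tendsto_atTop_add_const_right _ _ tendsto_natCast_atTop_atTop)).const_sub 1
        rw [sub_zero] at hlim
        obtain ⟨m, hm⟩ := (eventually_all.2 fun i => hlim.eventually (lt_mem_nhds (hlt i))).exists
        exact Set.mem_iUnion.2 ⟨m, fun i => (hm i).le⟩
    refine (ENNReal.tendsto_toReal (measure_ne_top _ _)).comp ?_
    rw [← hUnion]
    refine tendsto_measure_iUnion_atTop fun m m' hm => hmono ?_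
    have : (m : ℝ) ≤ m' := by exact_mod_cast hm
    gcongr
  rw [Metric.tendsto_nhds]
  intro ε hε
  obtain ⟨m, hm1, hm2⟩ := ((hright.eventually (gt_mem_nhds (lt_add_of_pos_right _ hε))).and
    (hleft.eventually (lt_mem_nhds (sub_lt_self _ hε)))).exists
  set t : ℝ := 1 / ((m : ℝ) + 2) with ht
  have ht0 : 0 < t := by positivity
  have ht1 : t ≤ 1 / 2 := by
    rw [ht]; gcongr; linarith [(Nat.cast_nonneg m : (0 : ℝ) ≤ m)]
  -- The difference quotients converge, and for the limit law they are squeezed by `hm1` and `hm2`.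
  have hup := ((h (Fin.cons (1 + t) y)).sub (h (Fin.cons 1 y))).div_const t
  have hlo := ((h (Fin.cons (1 - t + t) y)).sub (h (Fin.cons (1 - t) y))).div_const t
  have hup0 : (fNorm F₀ (Fin.cons (1 + t) y) - fNorm F₀ (Fin.cons 1 y)) / t <
      (law F₀).real (S 1) + ε := by
    refine lt_of_le_of_lt ?_ hm1
    rw [div_le_iff₀' ht0]
    exact fNorm_sub_le_mul_measureReal hF₀ y zero_le_one ht0.le
  have hlo0 : (law F₀).real (S 1) - ε <
      (fNorm F₀ (Fin.cons (1 - t + t) y) - fNorm F₀ (Fin.cons (1 - t) y)) / t := by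
    refine lt_of_lt_of_le hm2 ?_
    rw [le_div_iff₀' ht0]
    exact mul_measureReal_le hF₀ y (by linarith) ht0.le
  filter_upwards [hup.eventually (gt_mem_nhds hup0), hlo.eventually (lt_mem_nhds hlo0)]
    with n hn1 hn2
  have h1 := (le_div_iff₀' ht0).2 (mul_measureReal_le (hF n) y zero_le_one ht0.le)
  have h2 := (div_le_iff₀' ht0).2
    (fNorm_sub_le_mul_measureReal (hF n) y (s := 1 - t) (by linarith) ht0.le)
  rw [sub_add_cancel] at h2 hn2
  rw [Real.dist_eq, abs_lt]
  constructor <;> simp only [hS] at * <;> linarith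

/-- Pointwise convergence of the `F`-norms implies convergence in the Wasserstein distance. -/
theorem tendsto_wassersteinDist_of_tendsto_fNorm {d : ℕ} {F : ℕ → (Fin d → ℝ) → ℝ}
    {F₀ : (Fin d → ℝ) → ℝ} (hF : ∀ n, ConditionH (F n)) (hF₀ : ConditionH F₀)
    (h : ∀ x, Tendsto (fun n => fNorm (F n) x) atTop (𝓝 (fNorm F₀ x))) :
    Tendsto (fun n => wassersteinDist (F n) F₀) atTop (𝓝 0) := by
  have hmean : ∀ G : (Fin d → ℝ) → ℝ, ConditionH G →
      ∫⁻ x, ENNReal.ofReal (∑ i, x i) ∂law G =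
        ENNReal.ofReal (∑ i : Fin d, fNorm G (Pi.single i.succ 1)) := fun G hG => by
    simp only [fNorm_single hG]
    rw [← integral_finsetSum _ fun i _ => (hG.2 i).2.1, ofReal_integral_eq_lintegral_ofReal
      (integrable_finsetSum _ fun i _ => (hG.2 i).2.1)]
    filter_upwards [hG.ae_nonneg] with X hX using Finset.sum_nonneg fun i _ => hX i
  refine tendsto_wassersteinDist_of_tendsto_Iic (fun n => (hF n).1) hF₀.1
    (fun n i => ((hF n).2 i).1) (fun i => (hF₀.2 i).1) ?_ ?_ (tendsto_law_Iic hF hF₀ h)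
  · rw [hmean F₀ hF₀]
    exact ENNReal.ofReal_ne_top
  · simp only [hmean _ (hF _), hmean F₀ hF₀]
    exact ENNReal.tendsto_ofReal (tendsto_finsetSum _ fun i _ => h _)

end FNorm

/-- Convergence in the Wasserstein metric of distribution functions satisfying `(H)` is equivalent
to convergence of the unit spheres of the `F`-norms in the Hausdorff metric of any norm `p` on
`ℝ^{d+1}` (a norm is a seminorm that vanishes only at `0`). -/
theorem mainTheorem8 (d : ℕ) (hd : 1 ≤ d) (F : ℕ → (Fin d → ℝ) → ℝ) (F₀ : (Fin d → ℝ) → ℝ)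
    (hF : ∀ n, FNorm.ConditionH (F n)) (hF₀ : FNorm.ConditionH F₀)
    (p : Seminorm ℝ (Fin (d + 1) → ℝ)) (hp : ∀ x, p x = 0 → x = 0) :
    Tendsto (fun n => FNorm.wassersteinDist (F n) F₀) atTop (𝓝 0) ↔
      Tendsto (fun n => FNorm.hausdorffDistOf p (FNorm.unitSphere (F n)) (FNorm.unitSphere F₀))
        atTop (𝓝 0) := by
  constructor
  · intro h
    refine FNorm.tendsto_hausdorffDistOf_sphere p (fun n => FNorm.fSeminorm (hF n))
      (FNorm.fSeminorm hF₀) (FNorm.eq_zero_of_fSeminorm_eq_zero hF₀) fun ε hε => ?_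
    obtain ⟨C, hC, hle⟩ := FNorm.exists_seminorm_le_mul (normSeminorm ℝ (Fin (d + 1) → ℝ))
      (FNorm.fSeminorm hF₀) (FNorm.eq_zero_of_fSeminorm_eq_zero hF₀)
    filter_upwards [h.eventually (gt_mem_nhds (ENNReal.ofReal_pos.2 (div_pos hε hC)))] with n hn x
    calc |FNorm.fNorm (F n) x - FNorm.fNorm F₀ x| ≤ ε / C * ‖x‖ :=
          FNorm.abs_fNorm_sub_le (hF n) hF₀ (div_pos hε hC) hn x
      _ ≤ ε / C * (C * FNorm.fSeminorm hF₀ x) := by gcongr; exact hle x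
      _ = ε * FNorm.fSeminorm hF₀ x := by field_simp
  · intro h
    exact FNorm.tendsto_wassersteinDist_of_tendsto_fNorm hF hF₀
      (FNorm.tendsto_of_tendsto_hausdorffDistOf_sphere p hp (fun n => FNorm.fSeminorm (hF n))
        (FNorm.fSeminorm hF₀) (fun n => FNorm.eq_zero_of_fSeminorm_eq_zero (hF n))
        (FNorm.eq_zero_of_fSeminorm_eq_zero hF₀) h)
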